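/- Let $N\ge 1$ be an integer and let $Z$ be a metric space. Let $h:[0,1]^N\to X\subseteq Z$ be a homeomorphism of $[0,1]^N$ onto its image $X$, and set $$X_\ell:=h(\{x\in[0,1]^N: x_N=0\}),\qquad X_r:=h(\{x\in[0,1]^N: x_N=1\}),\qquad X^-:=X_\ell\cup X_r ,$$ so that $(X,X^-)$ is an oriented $N$-dimensional rectangle of $Z$. Let $\psi: Z\supseteq D_\psi\to Z$ be a map (not necessarily continuous on all of $D_\psi$), let $\mathcal D\subseteq X\cap D_\psi$, and let $\mathcal K\subseteq\mathcal D$ be a compact set. Suppose that $(\mathcal D,\mathcal K,\psi)$ stretches $(X,X^-)$ to itself along the paths, that is: $\psi$ is continuous on $\mathcal K$, and for every path (continuous map) $\gamma:[a,b]\to Z$ whose range is contained in $X$ and meets both $X_\ell$ and $X_r$, there is an interval $[c,d]\subseteq[a,b]$ such that $$\gamma([c,d])\subseteq\mathcal K,\qquad \psi(\gamma([c,d]))\subseteq X,\qquad \psi(\gamma([c,d]))\cap X_\ell\neq\emptyset,\qquad \psi(\gamma([c,d]))\cap X_r\neq\emptyset .$$ Then there exists $\tilde w\in\mathcal K$ such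 that $\psi(\tilde w)=\tilde w$. -/

import Mathlib

/-- A generalized `N`-dimensional rectangle of a metric space `Z`: a homeomorphism `h` of the cube
`[0,1]^N` onto its image in `Z`. -/
structure GeneralizedRectangle (N : ℕ) (Z : Type*) [MetricSpace Z] where
  /-- The parametrization `h`. -/
  h : (Fin N → unitInterval) → Z
  isEmbedding : Topology.IsEmbedding h

namespace GeneralizedRectangle

variable {N : ℕ} {Z : Type*} [MetricSpace Z]

/-- The underlying set `X = h([0,1]^N)`. -/
def carrier (R : GeneralizedRectangle N Z) : Set Z := Set.range R.h

/-- The left `i`-face `h([x_i = 0])`. -/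
def leftFace (R : GeneralizedRectangle N Z) (i : Fin N) : Set Z := R.h '' {x | x i = 0}

/-- The right `i`-face `h([x_i = 1])`. -/
def rightFace (R : GeneralizedRectangle N Z) (i : Fin N) : Set Z := R.h '' {x | x i = 1}

end GeneralizedRectangle

/-- The index of the last of `N ≥ 1` coordinates. -/
def lastCoord (N : ℕ) [NeZero N] : Fin N := ⟨N - 1, Nat.sub_lt (NeZero.pos N) one_pos⟩

/-- An oriented `N`-dimensional rectangle (`N ≥ 1`) of a metric space `Z`: the image `X` of a
generalized rectangle, together with its two opposite faces `X_ℓ = h([x_N = 0])` and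
`X_r = h([x_N = 1])`. -/
structure OrientedRectangle (N : ℕ) [NeZero N] (Z : Type*) [MetricSpace Z] where
  /-- The set `X`. -/
  carrier : Set Z
  /-- The left side `X_ℓ`. -/
  left : Set Z
  /-- The right side `X_r`. -/
  right : Set Z
  exists_param : ∃ R : GeneralizedRectangle N Z, carrier = R.carrier ∧
    left = R.leftFace (lastCoord N) ∧ right = R.rightFace (lastCoord N)

/-- The set `X^- = X_ℓ ∪ X_r`. -/
def OrientedRectangle.sides {N : ℕ} [NeZero N] {Z : Type*} [MetricSpace Z]
    (X : OrientedRectangle N Z) : Set Z := X.left ∪ X.right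

/-- `(D, K, ψ)` stretches `X` to `Y` along the paths, where `ψ : Z ⊇ Dψ → Z`. The map is given by
a total function, of which only the values on `Dψ` matter. A path is a continuous map on a compact
interval `[a, b]`, and its sub-paths are its restrictions to the intervals `[c, d] ⊆ [a, b]`. -/
structure StretchesAlongPaths {N : ℕ} [NeZero N] {Z : Type*} [MetricSpace Z]
    (Dψ D K : Set Z) (ψ : Z → Z) (X Y : OrientedRectangle N Z) : Prop where
  domain_subset : D ⊆ X.carrier ∩ Dψ
  isCompact : IsCompact K
  subset_domain : K ⊆ D
  continuousOn : ContinuousOn ψ K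
  stretches : ∀ (a b : ℝ) (γ : ℝ → Z), a ≤ b → ContinuousOn γ (Set.Icc a b) →
    γ '' Set.Icc a b ⊆ X.carrier →
    (γ '' Set.Icc a b ∩ X.left).Nonempty → (γ '' Set.Icc a b ∩ X.right).Nonempty →
    ∃ c d : ℝ, a ≤ c ∧ c ≤ d ∧ d ≤ b ∧
      γ '' Set.Icc c d ⊆ K ∧
      ψ '' (γ '' Set.Icc c d) ⊆ Y.carrier ∧
      (ψ '' (γ '' Set.Icc c d) ∩ Y.left).Nonempty ∧
      (ψ '' (γ '' Set.Icc c d) ∩ Y.right).Nonempty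

/-!
Transport the problem to the cube `Q = [0,1]^N` by `φ = h⁻¹ ∘ ψ ∘ h`, defined on the compact set `P`
of points `x` with `h x ∈ K` and `ψ (h x) ∈ X`. On a path from the left face to the right face the
stretching hypothesis provides a piece inside `P` along which `φ_N` takes both values `0` and `1`,
so `φ_N - x_N` vanishes somewhere on it: the closed set `S = {x ∈ P | φ_N x = x_N}` meets every path
from left to right, that is, it separates the two faces. A continuous `f` with zero set `S`,
nonnegative on the left face and nonpositive on the right one
(`exists_continuousMap_separating`), together with a Tietze extension `Φ` of `φ|_S`, gives the
continuous map `x ↦ (Φ_1 x, …, Φ_{N-1} x, x_N + f x)`, the last coordinate being truncated to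
`[0,1]`. It has a fixed point by Brouwer's theorem; the signs of `f` on the two faces force `f = 0`
there, so the fixed point lies in `S` and is fixed by `φ`
(`exists_fixedPoint_of_forall_path_meets`).

Brouwer's theorem is proved by integration. If `g` is `C¹` and vanishes off a compact set `B`, then
for every polynomial `f` the integral `∫_B f (x + t g x) det (1 + t g' x) dx` is a polynomial in
`t`; for small `t` the map `x ↦ x + t g x` is a bijection of `B` and the integral equals `∫_B f`, so
it does for `t = 1` too. By Stone–Weierstrass this extends to all continuous `f`
(`setIntegral_comp_mul_det_eq`), and a bump function `f` at `0` shows that `x + g x` has a zero.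
For `g = -χ G`, with `χ` a cutoff and `G` a smooth approximation of a bounded continuous map, this
is a fixed point of `G`.
-/

open Set Filter Topology MeasureTheory Polynomial

/-! ### Families of functions depending polynomially on a parameter -/

/-- The algebra of families `H : ℝ → C(E, ℝ)` that depend polynomially on the parameter: `H t` is
the value at the constant function `t` of a polynomial with coefficients in `C(E, ℝ)`. -/
noncomputable def polynomialFamilies (E : Type*) [TopologicalSpace E] :
    Subalgebra ℝ (ℝ → C(E, ℝ)) :=
  (AlgHom.pi (R := ℝ) (A := fun _ : ℝ => C(E, ℝ)) fun t =>
    (aeval (R := C(E, ℝ)) (algebraMap ℝ C(E, ℝ) t)).restrictScalars ℝ).range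

section PolynomialFamilies

variable {E : Type*} [TopologicalSpace E]

theorem mem_polynomialFamilies {H : ℝ → C(E, ℝ)} :
    H ∈ polynomialFamilies E ↔
      ∃ Q : C(E, ℝ)[X], ∀ t, Q.eval (algebraMap ℝ C(E, ℝ) t) = H t := by
  simp [polynomialFamilies, AlgHom.mem_range, funext_iff, Polynomial.aeval_def,
    Polynomial.eval₂_eq_eval_map]

theorem const_mem_polynomialFamilies (c : C(E, ℝ)) : (fun _ => c) ∈ polynomialFamilies E :=
  mem_polynomialFamilies.2 ⟨C c, fun t => by simp⟩

theorem algebraMap_mem_polynomialFamilies :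
    (fun t => algebraMap ℝ C(E, ℝ) t) ∈ polynomialFamilies E :=
  mem_polynomialFamilies.2 ⟨X, fun t => by simp⟩

theorem det_mem_polynomialFamilies {n : Type*} [Fintype n] [DecidableEq n]
    {M : Matrix n n (ℝ → C(E, ℝ))} (hM : ∀ i j, M i j ∈ polynomialFamilies E) :
    M.det ∈ polynomialFamilies E := by
  rw [Matrix.det_apply]
  refine sum_mem fun σ _ => ?_
  rw [Units.smul_def]
  exact zsmul_mem (prod_mem fun i _ => hM _ _) _

/-- Integrating a polynomial family over a compact set gives a polynomial in the parameter. -/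
theorem exists_polynomial_setIntegral_eq [MeasurableSpace E] [OpensMeasurableSpace E]
    [T2Space E] {μ : Measure E}
    [IsFiniteMeasureOnCompacts μ] {B : Set E} (hB : IsCompact B) {H : ℝ → C(E, ℝ)}
    (hH : H ∈ polynomialFamilies E) :
    ∃ P : ℝ[X], ∀ t, ∫ x in B, H t x ∂μ = P.eval t := by
  obtain ⟨Q, hQ⟩ := mem_polynomialFamilies.1 hH
  refine ⟨∑ k ∈ Finset.range (Q.natDegree + 1), monomial k (∫ x in B, Q.coeff k x ∂μ),
    fun t => ?_⟩
  simp_rw [← hQ, eval_finsetSum, eval_monomial, eval_eq_sum_range, ContinuousMap.coe_sum,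
    Finset.sum_apply, ContinuousMap.mul_apply, ContinuousMap.pow_apply,
    _root_.algebraMap_apply, smul_eq_mul, mul_one]
  rw [integral_finsetSum _ fun k _ =>
    ((by fun_prop : Continuous fun x => Q.coeff k x * t ^ k).continuousOn.integrableOn_compact hB)]
  simp_rw [integral_mul_const]

end PolynomialFamilies

/-! ### Integrals along a compactly supported displacement -/

/-- A map that is the identity off a ball, and a bijection, maps that ball onto itself. -/
theorem image_eq_of_bijective_of_eqOn_compl {α : Type*} {f : α → α} {B : Set α}
    (hf : f.Bijective) (h : ∀ x ∉ B, f x = x) : f '' B = B := by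
  have h1 : f '' Bᶜ = Bᶜ := by
    simpa using image_congr (f := f) (g := id) (s := Bᶜ) fun x hx => h x hx
  rw [← compl_inj_iff, ← image_compl_eq hf, h1]

section Displacement

variable {E : Type*} [NormedAddCommGroup E] [NormedSpace ℝ E] [CompleteSpace E]

/-- Small multiples of a Lipschitz displacement give bijections of a Banach space. -/
theorem LipschitzWith.bijective_id_add_smul {g : E → E} {C : NNReal} (hg : LipschitzWith C g)
    {t : ℝ} (ht : ‖t‖₊ * C < 1) : Function.Bijective fun x => x + t • g x := by
  have h1 : ApproximatesLinearOn (fun x => x + t • g x)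
      ((ContinuousLinearEquiv.refl ℝ E : E ≃L[ℝ] E) : E →L[ℝ] E) univ (‖t‖₊ * C) := by
    rw [ApproximatesLinearOn.approximatesLinearOn_iff_lipschitzOnWith, lipschitzOnWith_univ]
    have : ((fun x => x + t • g x) -
        ⇑((ContinuousLinearEquiv.refl ℝ E : E ≃L[ℝ] E) : E →L[ℝ] E)) = fun x => t • g x := by
      ext x; simp
    rw [this]
    exact (lipschitzWith_smul t).comp hg
  have h2 : Subsingleton E ∨ ‖t‖₊ * C <
      ‖((ContinuousLinearEquiv.refl ℝ E).symm : E →L[ℝ] E)‖₊⁻¹ := by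
    rcases subsingleton_or_nontrivial E with h | h
    · exact Or.inl h
    · right
      have : ‖((ContinuousLinearEquiv.refl ℝ E).symm : E →L[ℝ] E)‖₊ = 1 :=
        ContinuousLinearMap.nnnorm_id
      rw [this]; simpa using ht
  exact ⟨injOn_univ.1 (h1.injOn h2), h1.surjective h2⟩

end Displacement

variable {N : ℕ}

local notation "𝔼" => (Fin N → ℝ)

/-- The Jacobian determinant of `x ↦ x + t • g x` is a polynomial family. -/
theorem exists_polynomialFamilies_det {g : 𝔼 → 𝔼} (hg : ContDiff ℝ 1 g) :
    ∃ H ∈ polynomialFamilies 𝔼, ∀ t x,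
      H t x = (ContinuousLinearMap.id ℝ 𝔼 + t • fderiv ℝ g x).det := by
  have hJ : ∀ i j, Continuous fun x => fderiv ℝ g x (Pi.single j 1) i := fun i j =>
    (continuous_apply i).comp ((hg.continuous_fderiv (by norm_num)).clm_apply continuous_const)
  let J : Matrix (Fin N) (Fin N) C(𝔼, ℝ) := fun i j => ⟨_, hJ i j⟩
  let M : Matrix (Fin N) (Fin N) (ℝ → C(𝔼, ℝ)) :=
    fun i j t => (1 : Matrix _ _ C(𝔼, ℝ)) i j + algebraMap ℝ C(𝔼, ℝ) t * J i j
  refine ⟨M.det, det_mem_polynomialFamilies fun i j => ?_, fun t x => ?_⟩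
  · exact add_mem (const_mem_polynomialFamilies _)
      (mul_mem algebraMap_mem_polynomialFamilies (const_mem_polynomialFamilies _))
  · let ev : (ℝ → C(𝔼, ℝ)) →+* ℝ :=
      ((ContinuousMap.evalAlgHom ℝ ℝ x : C(𝔼, ℝ) →ₐ[ℝ] ℝ) : C(𝔼, ℝ) →+* ℝ).comp
        (Pi.evalRingHom (fun _ : ℝ => C(𝔼, ℝ)) t)
    have h1 : M.det t x = ev M.det := rfl
    rw [h1, RingHom.map_det, ContinuousLinearMap.det, ← LinearMap.det_toMatrix']
    congr 1
    ext i j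
    have h2 : (1 : Matrix (Fin N) (Fin N) C(𝔼, ℝ)) i j x = (1 : Matrix (Fin N) (Fin N) ℝ) i j := by
      rw [Matrix.one_apply, Matrix.one_apply]; split_ifs <;> rfl
    have h3 : ev (M i j) = (1 : Matrix (Fin N) (Fin N) C(𝔼, ℝ)) i j x
        + t * fderiv ℝ g x (Pi.single j 1) i := by
      simp [ev, M, J, _root_.algebraMap_apply]
    rw [RingHom.mapMatrix_apply, Matrix.map_apply, h3, h2, LinearMap.toMatrix'_apply]
    simp [Matrix.one_apply, Pi.single_apply]

/-- Change of variables for a small displacement: for `t` near `0` the map `x ↦ x + t • g x` is a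
bijection of `B` with positive Jacobian determinant, so no absolute value is needed. -/
theorem eventually_setIntegral_comp_mul_det_eq {g : 𝔼 → 𝔼} (hg : ContDiff ℝ 1 g)
    {B : Set 𝔼} (hB : IsCompact B) (hgB : ∀ x ∉ B, g x = 0) (f : 𝔼 → ℝ) :
    ∀ᶠ t : ℝ in 𝓝 0, ∫ x in B, f (x + t • g x) *
      (ContinuousLinearMap.id ℝ 𝔼 + t • fderiv ℝ g x).det = ∫ x in B, f x := by
  have hsupp : HasCompactSupport g := HasCompactSupport.intro hB hgB
  obtain ⟨C, hC⟩ := hg.lipschitzWith_of_hasCompactSupport hsupp (by norm_num)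
  have h1 : ∀ᶠ t : ℝ in 𝓝 0, ‖t‖₊ * C < 1 :=
    (by fun_prop : Continuous fun t : ℝ => ‖t‖₊ * C).continuousAt.eventually_lt_const (by simp)
  have h2 : ∀ᶠ t : ℝ in 𝓝 0, ∀ x ∈ B,
      0 < (ContinuousLinearMap.id ℝ 𝔼 + t • fderiv ℝ g x).det := by
    refine hB.eventually_forall_of_forall_eventually fun x _ => ?_
    have hc : Continuous fun p : ℝ × 𝔼 =>
        (ContinuousLinearMap.id ℝ 𝔼 + p.1 • fderiv ℝ g p.2).det := by
      refine ContinuousLinearMap.continuous_det.comp ?_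
      have := hg.continuous_fderiv (by norm_num)
      fun_prop
    refine hc.continuousAt.eventually_const_lt ?_
    simp [ContinuousLinearMap.det]
  filter_upwards [h1, h2] with t ht1 ht2
  have hbij := hC.bijective_id_add_smul ht1
  have himg : (fun x => x + t • g x) '' B = B :=
    image_eq_of_bijective_of_eqOn_compl hbij fun x hx => by simp [hgB x hx]
  have hderiv : ∀ x ∈ B, HasFDerivWithinAt (fun x => x + t • g x)
      (ContinuousLinearMap.id ℝ 𝔼 + t • fderiv ℝ g x) B x := fun x _ =>
    ((hasFDerivAt_id x).add
      (((hg.differentiable (by norm_num) x).hasFDerivAt).const_smul t)).hasFDerivWithinAt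
  have := integral_image_eq_integral_abs_det_fderiv_smul volume hB.measurableSet hderiv
    hbij.injective.injOn f
  rw [himg] at this
  rw [this]
  refine setIntegral_congr_fun hB.measurableSet fun x hx => ?_
  simp [abs_of_pos (ht2 x hx), mul_comm]

/-- The algebra of functions `f` that become polynomial families along the
displacement `x ↦ x + t • g x`. -/
noncomputable def polynomialAlong (g : C(𝔼, 𝔼)) : Subalgebra ℝ C(𝔼, ℝ) :=
  (polynomialFamilies 𝔼).comap (AlgHom.pi (R := ℝ) (A := fun _ : ℝ => C(𝔼, ℝ)) fun t =>
    ContinuousMap.compRightAlgHom ℝ ℝ (ContinuousMap.id 𝔼 + t • g))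

theorem separatesPoints_polynomialAlong (g : C(𝔼, 𝔼)) :
    (polynomialAlong g).SeparatesPoints := by
  intro x y hxy
  obtain ⟨i, hi⟩ := Function.ne_iff.1 hxy
  let p : C(𝔼, ℝ) := ⟨fun x => x i, continuous_apply i⟩
  refine ⟨p, ⟨p, ?_, rfl⟩, hi⟩
  have : (fun _ => p) + (fun t => algebraMap ℝ C(𝔼, ℝ) t) *
      (fun _ => p.comp g) ∈ polynomialFamilies 𝔼 :=
    add_mem (const_mem_polynomialFamilies _)
      (mul_mem algebraMap_mem_polynomialFamilies (const_mem_polynomialFamilies _))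
  change _ ∈ polynomialFamilies 𝔼
  convert this using 1
  ext t x
  simp [p, _root_.algebraMap_apply]

/-- Both sides are values at `t = 1` of polynomials in the size `t` of the displacement, which agree
for small `t`. -/
theorem setIntegral_comp_mul_det_eq_of_mem {g : C(𝔼, 𝔼)} (hg : ContDiff ℝ 1 g)
    {B : Set 𝔼} (hB : IsCompact B) (hgB : ∀ x ∉ B, g x = 0) {f : C(𝔼, ℝ)}
    (hf : f ∈ polynomialAlong g) :
    ∫ x in B, f (x + g x) * (ContinuousLinearMap.id ℝ 𝔼 + fderiv ℝ g x).det = ∫ x in B, f x := by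
  obtain ⟨H, hH, hHdet⟩ := exists_polynomialFamilies_det hg
  obtain ⟨P, hP⟩ := exists_polynomial_setIntegral_eq (μ := volume) hB (mul_mem hf hH)
  have hP' : ∀ t : ℝ, ∫ x in B, f (x + t • g x) *
      (ContinuousLinearMap.id ℝ 𝔼 + t • fderiv ℝ g x).det = P.eval t := fun t => by
    rw [← hP t]
    simp_rw [← hHdet]
    rfl
  have hev : ∀ᶠ t : ℝ in 𝓝 0, P.eval t = (Polynomial.C (∫ x in B, f x)).eval t := by
    filter_upwards [eventually_setIntegral_comp_mul_det_eq hg hB hgB f] with t ht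
    rw [← hP', ht, eval_C]
  have hPC : P = Polynomial.C (∫ x in B, f x) :=
    eq_of_infinite_eval_eq _ _ (infinite_of_mem_nhds 0 hev)
  have := hP' 1
  simpa [hPC] using this

/-- The change of variables formula for `x ↦ x + g x`, which need not be injective. It passes from
`polynomialAlong g` to all continuous `f` by Stone–Weierstrass. -/
theorem setIntegral_comp_mul_det_eq {g : C(𝔼, 𝔼)} (hg : ContDiff ℝ 1 g)
    {B : Set 𝔼} (hB : IsCompact B) (hgB : ∀ x ∉ B, g x = 0) (f : C(𝔼, ℝ)) :
    ∫ x in B, f (x + g x) * (ContinuousLinearMap.id ℝ 𝔼 + fderiv ℝ g x).det = ∫ x in B, f x := by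
  obtain ⟨D, hD⟩ : ∃ D : 𝔼 → ℝ,
      D = fun x => (ContinuousLinearMap.id ℝ 𝔼 + fderiv ℝ g x).det := ⟨_, rfl⟩
  suffices ∫ x in B, f (x + g x) * D x = ∫ x in B, f x by rwa [hD] at this
  have hDc : Continuous D := by
    rw [hD]
    refine ContinuousLinearMap.continuous_det.comp ?_
    have := hg.continuous_fderiv (by norm_num)
    fun_prop
  have hφ : Continuous fun x => x + g x := by fun_prop
  have hint : ∀ {u : 𝔼 → ℝ}, Continuous u → IntegrableOn u B := fun hu =>
    hu.continuousOn.integrableOn_compact hB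
  -- Replacing `f` by a function at distance `ε` changes the two sides by at most `ε * c` in all.
  set c : ℝ := ∫ x in B, (|D x| + 1) with hc
  have key : ∀ ε > 0, |(∫ x in B, f (x + g x) * D x) - ∫ x in B, f x| ≤ ε * c := by
    intro ε hε
    obtain ⟨p, hp, hpf⟩ :=
      ContinuousMap.exists_mem_subalgebra_near_continuous_of_isCompact_of_separatesPoints
        (separatesPoints_polynomialAlong g) f (hB.union (hB.image hφ)) hε
    have h0 : ∫ x in B, p (x + g x) * D x = ∫ x in B, p x :=
      by rw [hD]; exact setIntegral_comp_mul_det_eq_of_mem hg hB hgB hp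
    have hi₁ : IntegrableOn (fun x => f (x + g x) * D x) B := hint (by fun_prop)
    have hi₂ : IntegrableOn f B := hint (by fun_prop)
    have hi₃ : IntegrableOn (fun x => p (x + g x) * D x) B := hint (by fun_prop)
    have hi₄ : IntegrableOn p B := hint (by fun_prop)
    have hi₅ : IntegrableOn (fun x => f (x + g x) * D x - f x) B := hi₁.sub hi₂
    have hi₆ : IntegrableOn (fun x => p (x + g x) * D x - p x) B := hi₃.sub hi₄
    rw [← sub_eq_zero, ← integral_sub hi₃ hi₄] at h0
    rw [← integral_sub hi₁ hi₂, ← sub_zero (integral _ _), ← h0,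
      ← integral_sub hi₅ hi₆, hc, ← integral_const_mul,
      ← Real.norm_eq_abs]
    have hi₇ : IntegrableOn (fun x => ε * (|D x| + 1)) B := hint (by fun_prop)
    refine norm_integral_le_of_norm_le hi₇ ?_
    refine (ae_restrict_iff' hB.measurableSet).2 (ae_of_all _ fun x hx => ?_)
    have h1 := hpf (x + g x) (Or.inr ⟨x, hx, rfl⟩)
    have h2 := hpf x (Or.inl hx)
    rw [Real.norm_eq_abs] at h1 h2 ⊢
    calc |f (x + g x) * D x - f x - (p (x + g x) * D x - p x)|
        = |(p x - f x) - (p (x + g x) - f (x + g x)) * D x| := by congr 1; ring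
      _ ≤ |p x - f x| + |p (x + g x) - f (x + g x)| * |D x| := by
          rw [← abs_mul]; exact abs_sub _ _
      _ ≤ ε + ε * |D x| := by gcongr
      _ = ε * (|D x| + 1) := by ring
  rw [← sub_eq_zero, ← abs_nonpos_iff]
  refine ge_of_tendsto (x := 𝓝[>] (0 : ℝ)) (b := _) (f := fun ε => ε * c) ?_
    (eventually_nhdsWithin_of_forall key)
  have : Tendsto (fun ε : ℝ => ε * c) (𝓝 0) (𝓝 (0 * c)) := (continuous_mul_const c).tendsto 0
  rw [zero_mul] at this
  exact this.mono_left nhdsWithin_le_nhds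

/-! ### Brouwer's fixed point theorem -/

/-- A `C¹` perturbation of the identity with compact support has a zero. -/
theorem exists_add_eq_zero_of_hasCompactSupport {g : 𝔼 → 𝔼} (hg : ContDiff ℝ 1 g)
    (hsupp : HasCompactSupport g) : ∃ x, x + g x = 0 := by
  by_contra! hne
  obtain ⟨R, hR⟩ := hsupp.isCompact.isBounded.subset_closedBall 0
  set B : Set 𝔼 := Metric.closedBall 0 (max R 1) with hBdef
  have hB : IsCompact B := isCompact_closedBall _ _
  have hgB : ∀ x ∉ B, g x = 0 := fun x hx => by
    refine image_eq_zero_of_notMem_tsupport fun h => hx ?_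
    exact Metric.closedBall_subset_closedBall (le_max_left _ _) (hR h)
  have hφ : Continuous fun x => x + g x := continuous_id.add hg.continuous
  -- On `B` the map `x + g x` keeps a distance `ε` from `0`, so a bump `f` of radius `ε` at `0`
  -- vanishes along it.
  obtain ⟨x₀, hx₀, hmin⟩ := hB.exists_isMinOn ⟨0, by simp [hBdef]⟩ hφ.norm.continuousOn
  set ε : ℝ := ‖x₀ + g x₀‖ with hε
  have hεpos : 0 < ε := norm_pos_iff.2 (hne x₀)
  let f : C(𝔼, ℝ) := ⟨fun x => max 0 (ε - ‖x‖), by fun_prop⟩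
  have h1 := setIntegral_comp_mul_det_eq (g := ⟨g, hg.continuous⟩) hg hB hgB f
  have h2 : ∫ x in B, f (x + g x) * (ContinuousLinearMap.id ℝ 𝔼 + fderiv ℝ g x).det = 0 := by
    refine setIntegral_eq_zero_of_forall_eq_zero fun x hx => ?_
    have : f (x + g x) = 0 := max_eq_left (sub_nonpos.2 (hmin hx))
    rw [this, zero_mul]
  have h3 : 0 < ∫ x in B, f x := by
    refine (setIntegral_pos_iff_support_of_nonneg_ae (ae_of_all _ fun x => le_max_left _ _)
      (f.continuous.continuousOn.integrableOn_compact hB)).2 ?_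
    have hnhds : Function.support f ∩ B ∈ 𝓝 (0 : 𝔼) := by
      refine inter_mem (f.continuous.continuousAt.eventually_ne ?_)
        (Metric.closedBall_mem_nhds _ (by positivity))
      simp [f, hεpos.ne', hεpos.le]
    exact Measure.measure_pos_of_mem_nhds _ hnhds
  exact h3.ne' (h1.symm.trans h2)

/-- **Brouwer's fixed point theorem**, for bounded continuous self-maps of `ℝᴺ`. -/
theorem exists_fixedPoint_of_continuous_of_bounded {F : 𝔼 → 𝔼} (hF : Continuous F) {M : ℝ}
    (hM : ∀ x, ‖F x‖ ≤ M) : ∃ x, F x = x := by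
  by_contra! hne
  have hM0 : 0 ≤ M := (norm_nonneg _).trans (hM 0)
  -- The error is below the displacement `dist x (F x)`, so `G` has no fixed point either.
  obtain ⟨G, hG, hGF, -⟩ := hF.exists_contDiff_approx 1
    (ε := fun x => min 1 (dist x (F x))) (by fun_prop)
    (fun x => lt_min one_pos (dist_pos.2 (hne x).symm))
  have hGne : ∀ x, G x ≠ x := fun x hx => by
    have := (hGF x).trans_le (min_le_right _ _)
    rw [hx] at this
    exact this.false
  have hGM : ∀ x, ‖G x‖ ≤ M + 1 := fun x => by
    have h1 := ((hGF x).trans_le (min_le_left _ _)).le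
    rw [dist_eq_norm] at h1
    calc ‖G x‖ = ‖F x + (G x - F x)‖ := by congr 1; abel
      _ ≤ M + 1 := (norm_add_le _ _).trans (add_le_add (hM x) h1)
  -- The cutoff `χ` equals `1` on the ball of radius `M + 1`, which contains every solution of
  -- `x = χ x • G x`.
  let χ : ContDiffBump (0 : 𝔼) := ⟨M + 1, M + 2, by linarith, by linarith⟩
  obtain ⟨x, hx⟩ := exists_add_eq_zero_of_hasCompactSupport (g := fun x => -(χ x • G x))
    ((χ.contDiff.smul hG).neg) (χ.hasCompactSupport.smul_right.neg)
  rw [add_neg_eq_zero] at hx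
  have hxM : ‖x‖ ≤ M + 1 := by
    rw [hx, norm_smul, Real.norm_eq_abs, abs_of_nonneg χ.nonneg]
    exact (mul_le_of_le_one_left (norm_nonneg _) χ.le_one).trans (hGM x)
  rw [χ.one_of_mem_closedBall (by simpa [χ] using hxM), one_smul] at hx
  exact hGne x hx.symm

/-! ### Separating functions of closed sets cutting all paths -/

/-- In a locally path-connected metric space, a closed set that no path from `L` to `R` avoids is
the zero set of a continuous function which is nonnegative on `L` and nonpositive on `R`. -/
theorem exists_continuousMap_separating {X : Type*} [PseudoMetricSpace X]
    [LocallyPathConnectedSpace X] {T L R : Set X} (hT : IsClosed T) (hne : T.Nonempty)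
    (hcut : ∀ x ∈ L, ∀ y ∈ R, ¬ JoinedIn Tᶜ x y) :
    ∃ f : C(X, ℝ), (∀ x, f x = 0 ↔ x ∈ T) ∧ (∀ x ∈ L, 0 ≤ f x) ∧ ∀ x ∈ R, f x ≤ 0 := by
  classical
  -- `A` is the side of `L`; `f` is the distance to `T`, with a minus sign off `A`.
  set A : Set X := {x | ∃ y ∈ L, JoinedIn Tᶜ y x} with hA
  have hAopen : IsOpen A := by
    have : A = ⋃ y ∈ L, pathComponentIn Tᶜ y := by ext x; simp [hA, pathComponentIn]
    rw [this]
    exact isOpen_biUnion fun y _ => hT.isOpen_compl.pathComponentIn y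
  have hAT : ∀ x ∈ frontier A, x ∈ T := by
    intro x hx
    rw [hAopen.frontier_eq] at hx
    by_contra hxT
    obtain ⟨z, hz, y, hy, hyz⟩ := mem_closure_iff.1 hx.1 _
      (hT.isOpen_compl.pathComponentIn x) (mem_pathComponentIn_self hxT)
    exact hx.2 ⟨y, hy, hyz.trans (JoinedIn.symm hz)⟩
  have hdist : Continuous fun x => Metric.infDist x T := Metric.continuous_infDist_pt T
  have hzero : ∀ x, Metric.infDist x T = 0 ↔ x ∈ T := fun x =>
    (hT.mem_iff_infDist_zero hne).symm
  refine ⟨⟨fun x => if x ∈ A then Metric.infDist x T else -Metric.infDist x T,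
    Continuous.if (fun x hx => ?_) hdist hdist.neg⟩, fun x => ?_, fun x hx => ?_, fun x hx => ?_⟩
  · rw [(hzero x).2 (hAT x hx), neg_zero]
  · simp only [ContinuousMap.coe_mk]
    split_ifs
    · exact hzero x
    · rw [neg_eq_zero, hzero]
  · simp only [ContinuousMap.coe_mk]
    split_ifs with h
    · exact Metric.infDist_nonneg
    · have : x ∈ T := by
        by_contra hxT
        exact h ⟨x, hx, JoinedIn.refl hxT⟩
      rw [(hzero x).2 this, neg_zero]
  · have h : x ∉ A := fun ⟨y, hy, hyx⟩ => hcut y hy x hx hyx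
    simpa [h] using Metric.infDist_nonneg

/-! ### Fixed points on sets separating two faces of the cube -/

/-- The coordinatewise retraction of `ℝᴺ` onto the unit cube. -/
noncomputable def cubeRetraction (x : 𝔼) : Fin N → unitInterval :=
  fun i => projIcc 0 1 zero_le_one (x i)

theorem continuous_cubeRetraction : Continuous (cubeRetraction (N := N)) :=
  continuous_pi fun i => continuous_projIcc.comp (continuous_apply i)

theorem cubeRetraction_coe (q : Fin N → unitInterval) :
    cubeRetraction (fun i => (q i : ℝ)) = q :=
  funext fun i => projIcc_val zero_le_one (q i)

/-- If `S` meets every path joining the two faces of the cube in the direction `k`, and `φ`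
preserves the `k`-th coordinate on `S`, then `φ` has a fixed point in `S`. -/
theorem exists_fixedPoint_of_forall_path_meets {k : Fin N} {S : Set (Fin N → unitInterval)}
    (hS : IsClosed S) {φ : (Fin N → unitInterval) → Fin N → unitInterval}
    (hφ : ContinuousOn φ S) (hk : ∀ x ∈ S, φ x k = x k)
    (hcut : ∀ p : C(unitInterval, Fin N → unitInterval), p 0 k = 0 → p 1 k = 1 → ∃ t, p t ∈ S) :
    ∃ x ∈ S, φ x = x := by
  -- Working in `ℝᴺ` rather than in the cube: it is locally path-connected, and paths retract to the
  -- cube.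
  set T : Set 𝔼 := cubeRetraction ⁻¹' S with hTdef
  have hT : IsClosed T := hS.preimage continuous_cubeRetraction
  have hTne : T.Nonempty := by
    obtain ⟨t, ht⟩ := hcut ⟨fun t _ => t, by fun_prop⟩ rfl rfl
    exact ⟨fun _ => (t : ℝ), by rw [hTdef, mem_preimage, cubeRetraction_coe (fun _ => t)]; exact ht⟩
  obtain ⟨f, hf0, hfL, hfR⟩ := exists_continuousMap_separating (L := {x : 𝔼 | x k ≤ 0})
    (R := {x : 𝔼 | 1 ≤ x k}) hT hTne fun x hx y hy hxy => by
      obtain ⟨p, hp⟩ := hxy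
      obtain ⟨t, ht⟩ := hcut ⟨fun t => cubeRetraction (p t),
        continuous_cubeRetraction.comp p.continuous⟩
        (by simpa [cubeRetraction] using projIcc_of_le_left zero_le_one (show x k ≤ 0 from hx))
        (by simpa [cubeRetraction] using projIcc_of_right_le zero_le_one (show 1 ≤ y k from hy))
      exact hp t ht
  obtain ⟨Φ, hΦ⟩ := ContinuousMap.exists_restrict_eq hS
    (⟨S.domRestrict φ, hφ.domRestrict⟩ : C(S, Fin N → unitInterval))
  have hΦ' : ∀ x ∈ S, Φ x = φ x := fun x hx => DFunLike.congr_fun hΦ ⟨x, hx⟩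
  -- `f` pushes the `k`-th coordinate up on the side of the face `x k = 0` and down on the other
  -- side; neither is possible at a fixed point.
  let G : 𝔼 → Fin N → unitInterval := fun x =>
    Function.update (Φ (cubeRetraction x)) k (projIcc 0 1 zero_le_one (x k + f x))
  have hG : Continuous G :=
    (Φ.continuous.comp continuous_cubeRetraction).update k (continuous_projIcc.comp (by fun_prop))
  obtain ⟨x, hx⟩ := exists_fixedPoint_of_continuous_of_bounded
    (F := fun x i => (G x i : ℝ)) (M := 1) (by fun_prop) fun x =>
      (pi_norm_le_iff_of_nonneg zero_le_one).2 fun i => by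
        rw [Real.norm_eq_abs, abs_of_nonneg (G x i).2.1]; exact (G x i).2.2
  have hxG : cubeRetraction x = G x := by
    conv_lhs => rw [← hx]
    exact cubeRetraction_coe (G x)
  have hxk : max 0 (min 1 (x k + f x)) = x k := by
    have := congrFun hx k
    simpa [G, coe_projIcc] using this
  have hfx : f x = 0 := by
    rcases lt_trichotomy (f x) 0 with h | h | h
    · refine absurd (hfL x ?_) h.not_ge
      by_contra h'
      have h0 : 0 < x k := not_le.1 h'
      rcases max_choice 0 (min 1 (x k + f x)) with h' | h' <;> rw [h'] at hxk
      · linarith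
      · linarith [min_le_right 1 (x k + f x)]
    · exact h
    · refine absurd (hfR x ?_) h.not_ge
      by_contra h'
      have h0 : x k < 1 := not_le.1 h'
      have h1 := le_max_right 0 (min 1 (x k + f x))
      rcases min_choice 1 (x k + f x) with h' | h' <;> rw [h'] at h1 hxk <;> linarith
  have hxS : cubeRetraction x ∈ S := (hf0 x).1 hfx
  refine ⟨cubeRetraction x, hxS, funext fun i => ?_⟩
  by_cases hi : i = k
  · rw [hi, hk _ hxS]
  · conv_rhs => rw [hxG]
    simp [G, hi, hΦ' _ hxS]

/-! ### Stretching along paths -/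

theorem theorem5p1 {N : ℕ} [NeZero N] {Z : Type*} [MetricSpace Z] (X : OrientedRectangle N Z)
    (Dψ D K : Set Z) (ψ : Z → Z) (h_stretch : StretchesAlongPaths Dψ D K ψ X X) :
    ∃ w ∈ K, ψ w = w := by
  obtain ⟨⟨h, hemb⟩, hX, hl, hr⟩ := X.exists_param
  simp only [GeneralizedRectangle.carrier, GeneralizedRectangle.leftFace,
    GeneralizedRectangle.rightFace] at hX hl hr
  set k := lastCoord N
  have hc : Continuous h := hemb.continuous
  -- `φ = h⁻¹ ∘ ψ ∘ h`; off the set `P` below its values are junk.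
  let φ : (Fin N → unitInterval) → Fin N → unitInterval := fun x => Function.invFun h (ψ (h x))
  have hφ_of : ∀ {x y}, ψ (h x) = h y → φ x = y := fun {x y} hxy => by
    simp only [φ, hxy]
    exact Function.leftInverse_invFun hemb.injective y
  set P : Set (Fin N → unitInterval) := h ⁻¹' K ∩ (fun x => ψ (h x)) ⁻¹' range h with hP
  have hψh : ContinuousOn (fun x => ψ (h x)) (h ⁻¹' K) :=
    h_stretch.continuousOn.comp hc.continuousOn fun _ hx => hx
  have hPclosed : IsClosed P := hψh.preimage_isClosed_of_isClosed
    (h_stretch.isCompact.isClosed.preimage hc) (isCompact_range hc).isClosed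
  have hhφ : ∀ x ∈ P, h (φ x) = ψ (h x) := fun x hx => Function.invFun_eq hx.2
  have hφ : ContinuousOn φ P := by
    rw [hemb.isInducing.continuousOn_iff]
    exact (hψh.mono inter_subset_left).congr hhφ
  have hdiff : ContinuousOn (fun x => (φ x k : ℝ) - x k) P := by fun_prop
  obtain ⟨x, hx, hfix⟩ := exists_fixedPoint_of_forall_path_meets (k := k)
    (S := P ∩ (fun x => (φ x k : ℝ) - x k) ⁻¹' {0})
    (hdiff.preimage_isClosed_of_isClosed hPclosed isClosed_singleton)
    (hφ.mono inter_subset_left) (fun x hx => Subtype.ext (sub_eq_zero.1 hx.2)) fun p hp0 hp1 => by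
      have hq : Continuous fun t : ℝ => p (projIcc 0 1 zero_le_one t) := by fun_prop
      obtain ⟨c, d, -, -, -, hK, hψX, hψl, hψr⟩ := h_stretch.stretches 0 1
        (fun t => h (p (projIcc 0 1 zero_le_one t))) zero_le_one (hc.comp hq).continuousOn
        (by rw [hX]; rintro _ ⟨t, -, rfl⟩; exact mem_range_self _)
        ⟨_, ⟨0, by simp, rfl⟩, by rw [hl]; exact ⟨_, by simpa using hp0, rfl⟩⟩
        ⟨_, ⟨1, by simp, rfl⟩, by rw [hr]; exact ⟨_, by simpa using hp1, rfl⟩⟩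
      rw [hX] at hψX
      rw [hl] at hψl
      rw [hr] at hψr
      obtain ⟨_, ⟨_, ⟨u, hu, rfl⟩, rfl⟩, yu, hyu, hu'⟩ := hψl
      obtain ⟨_, ⟨_, ⟨v, hv, rfl⟩, rfl⟩, yv, hyv, hv'⟩ := hψr
      have hmem : MapsTo (fun t : ℝ => p (projIcc 0 1 zero_le_one t)) (Icc c d) P := fun t ht =>
        ⟨hK ⟨t, ht, rfl⟩, hψX ⟨_, ⟨t, ht, rfl⟩, rfl⟩⟩
      have hu0 := congrArg Subtype.val (congrFun (hφ_of hu'.symm) k)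
      have hv1 := congrArg Subtype.val (congrFun (hφ_of hv'.symm) k)
      rw [hyu.out, Icc.coe_zero] at hu0
      rw [hyv.out, Icc.coe_one] at hv1
      obtain ⟨t, ht, ht0⟩ := isPreconnected_Icc.intermediate_value hu hv
        (hdiff.comp hq.continuousOn hmem)
        (show (0 : ℝ) ∈ _ by
          constructor
          · simp only [Function.comp_apply, hu0, zero_sub, neg_nonpos]; exact (p _ k).2.1
          · simp only [Function.comp_apply, hv1, sub_nonneg]; exact (p _ k).2.2)
      exact ⟨_, hmem ht, ht0⟩
  refine ⟨h x, hx.1.1, ?_⟩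
  rw [← hhφ x hx.1, hfix]
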